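/- Let $\mathbb F_\infty$ be the free group on infinitely many generators $\{g_i\}_{i\in\mathbb Z}$, let $\lambda$ be its left regular representation on $\ell^2(\mathbb F_\infty)$, and let $C^*_r(\mathbb F_\infty)\subset\mathcal B(\ell^2(\mathbb F_\infty))$ be its reduced $C^*$-algebra, i.e. the norm-closed unital $*$-algebra generated by the unitaries $\lambda_g$, $g\in\mathbb F_\infty$. Let $\tau(a)=\langle\delta_e,a\delta_e\rangle$ be the canonical trace on $C^*_r(\mathbb F_\infty)$, where the inner product is linear in its second variable, and let $\alpha$ be the automorphism of $C^*_r(\mathbb F_\infty)$ induced by the free shift of the generators, i.e. $\alpha(\lambda_g)=\lambda_{\beta(g)}$, where $\beta$ is the automorphism of $\mathbb F_\infty$ with $\beta(g_i)=g_{i+1}$ for all $i\in\mathbb Z$. (A state is a positive linear functional of norm one.) Then $\alpha$ is $E$-strictly weak mixing with $E=\tau(\,\cdot\,)\mathbf 1$; that is, for every $x\in C^*_r(\mathbb F_\infty)$ and every state $\varphi$ on $C^*_r(\mathbb F_\infty)$, $$\lim_{n\to\infty}\frac1n\sum_{k=0}^{n-1}\bigl|\varphi(\alpha^k(x))-\varphi(E(x))\bigr|=0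 .$$ Moreover, $\alpha$ is strictly weak mixing in the sense of Mukhamedov and Temir: $\tau$ is the unique $\alpha$-invariant state on $C^*_r(\mathbb F_\infty)$, and for every $x\in C^*_r(\mathbb F_\infty)$ and every state $\psi$ on $C^*_r(\mathbb F_\infty)$, $$\lim_{n\to\infty}\frac1n\sum_{k=0}^{n-1}\bigl|\psi(\alpha^k(x))-\tau(x)\bigr|=0 .$$ -/

import Mathlib

open scoped InnerProductSpace ENNReal Topology ComplexOrder

noncomputable section

namespace CStarDyn

/-! ### `C*`-dynamical systems and strict weak mixing -/

section Dynamics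

variable (A : Type*) [CStarAlgebra A] [PartialOrder A] [StarOrderedRing A]

/-- A Markov operator on a unital `C*`-algebra: a completely positive, identity-preserving
linear map of the algebra into itself. -/
structure MarkovOperator extends CompletelyPositiveMap A A where
  map_one' : toFun 1 = 1

variable {A}

/-- The linear map underlying a Markov operator. -/
def MarkovOperator.toLin (T : MarkovOperator A) : A →ₗ[ℂ] A :=
  T.toCompletelyPositiveMap.toLinearMap

/-- An automorphism of a unital `C*`-algebra, as a Markov operator. -/
def MarkovOperator.ofAut (α : A ≃⋆ₐ[ℂ] A) : MarkovOperator A where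
  toLinearMap := α.toAlgEquiv.toLinearMap
  map_cstarMatrix_nonneg' k M hM :=
    CompletelyPositiveMapClass.map_cstarMatrix_nonneg' α k M hM
  map_one' := map_one α

/-- A state: a positive linear functional of norm one. -/
def IsState (φ : A →L[ℂ] ℂ) : Prop :=
  (∀ a : A, 0 ≤ a → 0 ≤ φ a) ∧ ‖φ‖ = 1

/-- The system `(A, T)` is `F`-strictly weak mixing:
`(1/n) ∑_{k<n} |φ(Tᵏ x) - φ(F x)| → 0` for all states `φ` and all `x`. -/
def IsStrictlyWeakMixingWrt (T : MarkovOperator A) (F : A →ₗ[ℂ] A) : Prop :=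
  ∀ φ : A →L[ℂ] ℂ, IsState φ → ∀ x : A,
    Filter.Tendsto
      (fun n : ℕ => (1 / (n : ℝ)) * ∑ k ∈ Finset.range n, ‖φ ((T.toLin ^ k) x) - φ (F x)‖)
      Filter.atTop (𝓝 0)

/-- The system `(A, T)` is strictly weak mixing with invariant state `φ`: `φ` is the unique
`T`-invariant state, and `(1/n) ∑_{k<n} |ψ(Tᵏ x) - φ(x)| → 0` for all states `ψ` and all `x`. -/
def IsStrictlyWeakMixingState (T : MarkovOperator A) (φ : A →L[ℂ] ℂ) : Prop :=
  (IsState φ ∧ ∀ x, φ (T.toLin x) = φ x) ∧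
  (∀ ψ : A →L[ℂ] ℂ, IsState ψ → (∀ x, ψ (T.toLin x) = ψ x) → ψ = φ) ∧
  ∀ ψ : A →L[ℂ] ℂ, IsState ψ → ∀ x : A,
    Filter.Tendsto
      (fun n : ℕ => (1 / (n : ℝ)) * ∑ k ∈ Finset.range n, ‖ψ ((T.toLin ^ k) x) - φ x‖)
      Filter.atTop (𝓝 0)

end Dynamics

/-! ### The reduced `C*`-algebra of a discrete group -/

/-- The Hilbert space `ℓ²(S)`. -/
abbrev L2 (S : Type*) : Type _ := lp (fun _ : S => ℂ) 2

/-- The unitary `ℓ²(S) → ℓ²(S')` induced by a bijection `e : S ≃ S'`: `(U ξ)(s') = ξ(e⁻¹ s')`. -/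
def permute {S S' : Type*} (e : S ≃ S') : L2 S ≃ₗᵢ[ℂ] L2 S' where
  toFun ξ := ⟨fun s => ξ (e.symm s), by
    have h := lp.memℓp ξ
    rw [memℓp_gen_iff (by norm_num)] at h
    exact memℓp_gen (e.symm.summable_iff.mpr h)⟩
  invFun ξ := ⟨fun s => ξ (e s), by
    have h := lp.memℓp ξ
    rw [memℓp_gen_iff (by norm_num)] at h
    exact memℓp_gen (e.summable_iff.mpr h)⟩
  map_add' ξ η := rfl
  map_smul' c ξ := rfl
  left_inv ξ := by
    apply lp.ext; funext s; simp
  right_inv ξ := by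
    apply lp.ext; funext s; simp
  norm_map' ξ := by
    have h2 : 0 < (2 : ℝ≥0∞).toReal := by norm_num
    rw [lp.norm_eq_tsum_rpow h2, lp.norm_eq_tsum_rpow h2]
    congr 1
    exact e.symm.tsum_eq (fun s => ‖ξ s‖ ^ (2 : ℝ≥0∞).toReal)

theorem permute_apply {S S' : Type*} (e : S ≃ S') (ξ : L2 S) (s : S') :
    permute e ξ s = ξ (e.symm s) := rfl

section Reduced

variable (G : Type*) [Group G]

variable {G} in
/-- The left regular representation: `(λ_g ξ)(h) = ξ(g⁻¹ h)`. -/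
def leftReg (g : G) : L2 G →L[ℂ] L2 G :=
  (permute (Equiv.mulLeft g)).toContinuousLinearEquiv.toContinuousLinearMap

/-- The reduced group `C*`-algebra `C*_r(G)`: the norm-closed unital `*`-subalgebra of `B(ℓ²(G))`
generated by the left translation operators. -/
def reducedCStar : StarSubalgebra ℂ (L2 G →L[ℂ] L2 G) :=
  (StarAlgebra.adjoin ℂ (Set.range (leftReg (G := G)))).topologicalClosure

instance : IsClosed (reducedCStar G : Set (L2 G →L[ℂ] L2 G)) :=
  StarSubalgebra.isClosed_topologicalClosure _

theorem leftReg_mem (g : G) : leftReg g ∈ reducedCStar G :=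
  StarSubalgebra.le_topologicalClosure _ (StarAlgebra.subset_adjoin ℂ _ ⟨g, rfl⟩)

/-- Positivity in `C*_r(G)` as an operator on `ℓ²(G)` is the positivity of its own
`C*`-algebra structure. -/
instance : StarOrderedRing (reducedCStar G) := by
  refine StarOrderedRing.of_nonneg_iff' (fun {x y} h z => ?_) (fun x => ?_)
  · have h' : (x : L2 G →L[ℂ] L2 G) ≤ y := h
    exact add_le_add_right h' (z : L2 G →L[ℂ] L2 G)
  constructor
  · intro hx
    have hx' : (0 : L2 G →L[ℂ] L2 G) ≤ x := hx
    have hsa : IsSelfAdjoint x := Subtype.ext hx'.isSelfAdjoint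
    have hsp : SpectrumRestricts x ContinuousMap.realToNNReal := by
      have h2 := SpectrumRestricts.nnreal_of_nonneg hx'
      rw [SpectrumRestricts.nnreal_iff] at h2 ⊢
      intro r hr
      refine h2 r ?_
      rw [← spectrum.preimage_algebraMap ℂ] at hr ⊢
      exact (StarSubalgebra.spectrum_eq (S := reducedCStar G)) ▸ hr
    obtain ⟨s, hs, -, h⟩ :=
      CFC.exists_sqrt_of_isSelfAdjoint_of_quasispectrumRestricts hsa hsp
    exact ⟨s, by rw [hs.star_eq, ← h]⟩
  · rintro ⟨s, rfl⟩
    exact star_mul_self_nonneg (s : L2 G →L[ℂ] L2 G)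

/-- The canonical trace `τ(a) = ⟨δ_e, a δ_e⟩` on `C*_r(G)`. -/
def canonicalTrace : reducedCStar G →L[ℂ] ℂ :=
  letI := Classical.decEq G
  let δ : L2 G := lp.single 2 (1 : G) (1 : ℂ)
  (innerSL ℂ δ).comp ((ContinuousLinearMap.apply ℂ (L2 G) δ).comp
    (reducedCStar G).toSubalgebra.toSubmodule.subtypeL)

theorem canonicalTrace_apply [DecidableEq G] (a : reducedCStar G) :
    canonicalTrace G a =
      ⟪(lp.single 2 (1 : G) (1 : ℂ) : L2 G), (a : L2 G →L[ℂ] L2 G) (lp.single 2 1 1)⟫_ℂ := by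
  obtain rfl : ‹DecidableEq G› = Classical.decEq G := Subsingleton.elim _ _
  rfl

/-- The map `E = τ(·)1` on `C*_r(G)`. -/
def traceExpectation : reducedCStar G →ₗ[ℂ] reducedCStar G :=
  (canonicalTrace G).toLinearMap.smulRight 1

variable {G}

theorem conj_leftReg (β : G ≃* G) (g : G) :
    (permute β.toEquiv).conjStarAlgEquiv (leftReg g) = leftReg (β g) := by
  refine ContinuousLinearMap.ext fun ξ => lp.ext (funext fun h => ?_)
  change ξ (β (g⁻¹ * β.symm h)) = ξ ((β g)⁻¹ * h)
  simp

theorem conj_mem (β : G ≃* G) {a : L2 G →L[ℂ] L2 G} (ha : a ∈ reducedCStar G) :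
    (permute β.toEquiv).conjStarAlgEquiv a ∈ reducedCStar G := by
  let f : (L2 G →L[ℂ] L2 G) →⋆ₐ[ℂ] (L2 G →L[ℂ] L2 G) :=
    (permute β.toEquiv).conjStarAlgEquiv.toStarAlgHom
  have hf : Continuous f := map_continuous f
  have h1 : (StarAlgebra.adjoin ℂ (Set.range (leftReg (G := G)))).map f ≤
      StarAlgebra.adjoin ℂ (Set.range (leftReg (G := G))) := by
    rw [StarAlgHom.map_adjoin]
    refine StarAlgebra.adjoin_le ?_
    rintro _ ⟨_, ⟨g, rfl⟩, rfl⟩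
    exact StarAlgebra.subset_adjoin ℂ _ ⟨β g, (conj_leftReg β g).symm⟩
  exact StarSubalgebra.topologicalClosure_mono h1
    (StarSubalgebra.map_topologicalClosure_le _ f hf ⟨a, ha, rfl⟩)

/-- The automorphism of `C*_r(G)` induced by an automorphism `β` of `G`, namely `a ↦ U a U*` with
`U δ_g = δ_{β g}`; by `inducedAut_leftReg` it is given by `λ_g ↦ λ_{β g}`. -/
def inducedAut (β : G ≃* G) : reducedCStar G ≃⋆ₐ[ℂ] reducedCStar G where
  toFun a := ⟨(permute β.toEquiv).conjStarAlgEquiv a, conj_mem β a.2⟩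
  invFun a := ⟨(permute β.symm.toEquiv).conjStarAlgEquiv a, conj_mem β.symm a.2⟩
  left_inv _ := Subtype.ext ((permute β.toEquiv).conjStarAlgEquiv.symm_apply_apply _)
  right_inv _ := Subtype.ext ((permute β.toEquiv).conjStarAlgEquiv.apply_symm_apply _)
  map_mul' _ _ := Subtype.ext (map_mul _ _ _)
  map_add' _ _ := Subtype.ext (map_add _ _ _)
  map_star' _ := Subtype.ext (map_star _ _)
  map_smul' _ _ := Subtype.ext (map_smul _ _ _)

theorem inducedAut_leftReg (β : G ≃* G) (g : G) :
    inducedAut β ⟨leftReg g, leftReg_mem G g⟩ = ⟨leftReg (β g), leftReg_mem G (β g)⟩ :=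
  Subtype.ext (conj_leftReg β g)

end Reduced

/-- The free shift `g_i ↦ g_{i+1}` of the free group on generators `g_i`, `i ∈ ℤ`. -/
def freeShift : FreeGroup ℤ ≃* FreeGroup ℤ :=
  FreeGroup.freeGroupCongr (Equiv.addRight (1 : ℤ))

theorem freeShift_of (i : ℤ) : freeShift (FreeGroup.of i) = FreeGroup.of (i + 1) := by
  simp [freeShift]

end CStarDyn

end

open scoped InnerProductSpace ENNReal Topology ComplexOrder

noncomputable section

namespace CStarDyn

/-! ### States are unital -/

section States

variable {A : Type*} [CStarAlgebra A] [PartialOrder A] [StarOrderedRing A]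

/-! For a bounded functional `φ`, the `x` whose averages tend to zero form a closed subspace, since
the iterates of the shift are isometric; so `x = λ_g` suffices (`tendsto_avg_of_leftReg`). The case
`g = 1` is trivial. If `g ≠ 1` then `τ(λ_g) = 0`, and with suitable phases `c_k` the sum of the
`|φ(λ_{β^k g})|` equals `φ(∑ c_k λ_{β^k g})`, so a bound `O(√n)` on the norm of `∑ c_k λ_{β^k g}`
makes the averages `O(1/√n)`.

That bound is a ping-pong argument (`norm_sum_smul_leftReg_le`). Let `A_k` be the words whose first
index occurs in `β^k g`. Multiplying a word outside `A_k` by `β^k g` causes no cancellation and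
lands in `A_k`, and a word lies in at most `|g|` of the sets `A_k`.

Positivity enters only through `φ 1 = 1`, which turns `φ ∘ E` into `τ`. Uniqueness of the invariant
state follows from the convergence. -/

theorem re_apply_le_of_isSelfAdjoint {φ : A →L[ℂ] ℂ} (hφ : ∀ a : A, 0 ≤ a → 0 ≤ φ a)
    {a : A} (ha : IsSelfAdjoint a) : (φ a).re ≤ ‖a‖ * (φ 1).re ∧ (φ a).im = 0 := by
  have h1 : 0 ≤ φ 1 := hφ 1 zero_le_one
  have h := hφ _ (sub_nonneg.mpr (IsSelfAdjoint.le_algebraMap_norm_self ha))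
  have e : φ (algebraMap ℝ A ‖a‖) = (‖a‖ : ℂ) * φ 1 := by
    rw [Algebra.algebraMap_eq_smul_one, ← Complex.coe_smul, map_smul, smul_eq_mul]
  rw [map_sub, e, Complex.le_def] at h
  rw [Complex.le_def] at h1
  simp only [Complex.zero_re, Complex.sub_re, Complex.mul_re, Complex.ofReal_re,
    Complex.ofReal_im, Complex.zero_im, Complex.sub_im, Complex.mul_im] at h h1
  rw [← h1.2] at h
  constructor
  · linarith [h.1]
  · linarith [h.2]

/-- The real part of `φ b` only sees the self-adjoint part of `b`; rotating `a` by a phase makes `φ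
a` real and nonnegative. -/
theorem norm_apply_le_of_nonneg {φ : A →L[ℂ] ℂ} (hφ : ∀ a : A, 0 ≤ a → 0 ≤ φ a) (a : A) :
    ‖φ a‖ ≤ (φ 1).re * ‖a‖ := by
  have h1 : 0 ≤ (φ 1).re := (Complex.le_def.mp (hφ 1 zero_le_one)).1
  have key : ∀ b : A, (φ b).re ≤ (φ 1).re * ‖b‖ := by
    intro b
    obtain ⟨hr, -⟩ := re_apply_le_of_isSelfAdjoint hφ (realPart b).2
    obtain ⟨-, hi⟩ := re_apply_le_of_isSelfAdjoint hφ (imaginaryPart b).2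
    have hb : (φ b).re = (φ (realPart b : A)).re := by
      conv_lhs => rw [← realPart_add_I_smul_imaginaryPart b]
      rw [map_add, map_smul]
      simp [hi]
    rw [hb, mul_comm]
    exact hr.trans (mul_le_mul_of_nonneg_right (realPart.norm_le b) h1)
  obtain ⟨c, hc, hca⟩ := Complex.exists_norm_eq_mul_self (φ a)
  have h := key (c • a)
  rwa [map_smul, smul_eq_mul, ← hca, Complex.ofReal_re, norm_smul, hc, one_mul] at h

theorem IsState.map_one {φ : A →L[ℂ] ℂ} (hφ : IsState φ) : φ 1 = 1 := by
  have h1 := Complex.le_def.mp (hφ.1 1 zero_le_one)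
  have hle : 1 ≤ (φ 1).re := hφ.2 ▸
    φ.opNorm_le_bound h1.1 (norm_apply_le_of_nonneg hφ.1)
  -- Nontriviality gives `‖1‖ = 1`, needed for the upper bound on `‖φ 1‖`.
  have : Nontrivial A := by
    refine ⟨1, 0, fun h => ?_⟩
    rw [h, map_zero] at hle
    norm_num at hle
  have hge : ‖φ 1‖ ≤ 1 := by simpa [hφ.2] using φ.le_opNorm 1
  refine Complex.ext (le_antisymm ((Complex.re_le_norm _).trans hge) hle) ?_
  simpa using h1.2.symm

end States

/-! ### Coordinate restrictions in `ℓ²` -/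

section Restrict

variable {S : Type*}

/-- The coordinate projection of `ℓ²(S)` onto the functions supported in `s`. -/
def restrict (s : Set S) (ξ : L2 S) : L2 S :=
  ⟨s.indicator ξ, by
    have h := lp.memℓp ξ
    rw [memℓp_gen_iff (by norm_num)] at h
    refine memℓp_gen (h.of_nonneg_of_le (fun _ => by positivity) fun i => ?_)
    refine Real.rpow_le_rpow (norm_nonneg _) ?_ (by norm_num)
    exact norm_indicator_le_norm_self _ _⟩

theorem restrict_apply (s : Set S) (ξ : L2 S) (i : S) : restrict s ξ i = s.indicator ξ i := rfl

theorem hasSum_sq_norm (ξ : L2 S) : HasSum (fun i => ‖ξ i‖ ^ 2) (‖ξ‖ ^ 2) := by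
  simpa using lp.hasSum_norm (p := 2) (by norm_num) ξ

theorem norm_restrict_le (s : Set S) (ξ : L2 S) : ‖restrict s ξ‖ ≤ ‖ξ‖ := by
  refine le_of_sq_le_sq ?_ (norm_nonneg _)
  refine hasSum_le (fun i => ?_) (hasSum_sq_norm _) (hasSum_sq_norm ξ)
  have := norm_indicator_le_norm_self (s := s) ξ i
  rw [restrict_apply]
  gcongr

theorem norm_sub_restrict_le (s : Set S) (ξ : L2 S) : ‖ξ - restrict s ξ‖ ≤ ‖ξ‖ := by
  have h : ξ - restrict s ξ = restrict sᶜ ξ :=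
    lp.ext (by rw [lp.coeFn_sub]; exact (Set.indicator_compl s ξ).symm)
  exact h ▸ norm_restrict_le _ ξ

theorem inner_restrict_right (s : Set S) (ξ η : L2 S) :
    ⟪η, restrict s ξ⟫_ℂ = ⟪restrict s η, ξ⟫_ℂ := by
  rw [lp.inner_eq_tsum, lp.inner_eq_tsum]
  refine tsum_congr fun i => ?_
  by_cases hi : i ∈ s <;> simp [restrict_apply, hi]

/-- Exchanging the sums, each coordinate `i` is counted once for every `A k` containing it, hence at
most `M` times. -/
theorem sum_sq_norm_restrict_le {ι : Type*} (F : Finset ι) (A : ι → Set S) (M : ℕ)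
    (hM : ∀ (i : S) (F' : Finset ι), (∀ k ∈ F', i ∈ A k) → F'.card ≤ M) (ξ : L2 S) :
    ∑ k ∈ F, ‖restrict (A k) ξ‖ ^ 2 ≤ M * ‖ξ‖ ^ 2 := by
  classical
  refine hasSum_le (fun i => ?_) (hasSum_sum fun k _ => hasSum_sq_norm (restrict (A k) ξ))
    ((hasSum_sq_norm ξ).mul_left (M : ℝ))
  have h : ∀ k ∈ F, ‖restrict (A k) ξ i‖ ^ 2 = if i ∈ A k then ‖ξ i‖ ^ 2 else 0 := by
    intro k _
    by_cases hi : i ∈ A k <;> simp [restrict_apply, hi]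
  rw [Finset.sum_congr rfl h, ← Finset.sum_filter, Finset.sum_const, nsmul_eq_mul]
  gcongr
  exact hM i _ fun k hk => (Finset.mem_filter.mp hk).2

theorem sum_norm_restrict_le {ι : Type*} (F : Finset ι) (A : ι → Set S) (M : ℕ)
    (hM : ∀ (i : S) (F' : Finset ι), (∀ k ∈ F', i ∈ A k) → F'.card ≤ M) (ξ : L2 S) :
    ∑ k ∈ F, ‖restrict (A k) ξ‖ ≤ √(F.card * M) * ‖ξ‖ := by
  refine le_of_sq_le_sq ?_ (by positivity)
  rw [mul_pow, Real.sq_sqrt (by positivity), mul_assoc]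
  exact sq_sum_le_card_mul_sum_sq.trans
    (mul_le_mul_of_nonneg_left (sum_sq_norm_restrict_le F A M hM ξ) (by positivity))

end Restrict

/-! ### A norm estimate for sums of translations -/

section Translations

variable {G : Type*} [Group G]

theorem leftReg_apply (g : G) (ξ : L2 G) (h : G) : leftReg g ξ h = ξ (g⁻¹ * h) := rfl

theorem norm_leftReg_apply (g : G) (ξ : L2 G) : ‖leftReg g ξ‖ = ‖ξ‖ :=
  (permute (Equiv.mulLeft g)).norm_map ξ

/-- If `g` maps the complement of `s` into `s`, then `λ_g` maps `ℓ²(sᶜ)` into `ℓ²(s)`. -/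
theorem restrict_leftReg_sub_restrict {g : G} {s : Set G} (hs : ∀ h ∉ s, g * h ∈ s) (ξ : L2 G) :
    restrict s (leftReg g (ξ - restrict s ξ)) = leftReg g (ξ - restrict s ξ) := by
  refine lp.ext (funext fun h => ?_)
  rw [restrict_apply]
  by_cases hh : h ∈ s
  · rw [Set.indicator_of_mem hh]
  · have : g⁻¹ * h ∈ s := by
      by_contra hc
      exact hh (by simpa using hs _ hc)
    rw [Set.indicator_of_notMem hh, leftReg_apply, lp.coeFn_sub, Pi.sub_apply, restrict_apply,
      Set.indicator_of_mem this, sub_self]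

/-- Split `ξ` along `s`: the part off `s` is moved into `s`, so it pairs only with the part of `η`
on `s`. -/
theorem norm_inner_leftReg_le {g : G} {s : Set G} (hs : ∀ h ∉ s, g * h ∈ s) (ξ η : L2 G) :
    ‖⟪η, leftReg g ξ⟫_ℂ‖ ≤ ‖η‖ * ‖restrict s ξ‖ + ‖restrict s η‖ * ‖ξ‖ := by
  have e : leftReg g ξ = leftReg g (restrict s ξ) + leftReg g (ξ - restrict s ξ) := by
    rw [← map_add, add_sub_cancel]
  rw [e, inner_add_right]
  refine (norm_add_le _ _).trans (add_le_add ?_ ?_)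
  · exact (norm_inner_le_norm _ _).trans_eq (by rw [norm_leftReg_apply])
  · rw [← restrict_leftReg_sub_restrict hs, inner_restrict_right]
    refine (norm_inner_le_norm _ _).trans ?_
    rw [norm_leftReg_apply]
    gcongr
    exact norm_sub_restrict_le s ξ

/-- Ping-pong bound: if `g k` maps the complement of `A k` into `A k` and the sets `A k` overlap at
most `M` times, then `‖∑ c_k λ_{g_k}‖ ≤ 2 √(n M)` for coefficients in the unit disc. -/
theorem norm_sum_smul_leftReg_le {ι : Type*} (F : Finset ι) (g : ι → G) (A : ι → Set G) (M : ℕ)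
    (hA : ∀ k, ∀ h ∉ A k, g k * h ∈ A k)
    (hM : ∀ (i : G) (F' : Finset ι), (∀ k ∈ F', i ∈ A k) → F'.card ≤ M)
    (c : ι → ℂ) (hc : ∀ k, ‖c k‖ ≤ 1) :
    ‖∑ k ∈ F, c k • leftReg (g k)‖ ≤ 2 * √(F.card * M) := by
  refine ContinuousLinearMap.opNorm_le_bound _ (by positivity) fun ξ => ?_
  set T := ∑ k ∈ F, c k • leftReg (g k)
  have key : ∀ η : L2 G, ‖⟪η, T ξ⟫_ℂ‖ ≤ 2 * √(F.card * M) * ‖ξ‖ * ‖η‖ := by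
    intro η
    have e : ⟪η, T ξ⟫_ℂ = ∑ k ∈ F, c k * ⟪η, leftReg (g k) ξ⟫_ℂ := by
      simp only [T, sum_apply, inner_sum, smul_apply, inner_smul_right]
    calc ‖⟪η, T ξ⟫_ℂ‖ ≤ ∑ k ∈ F, ‖c k * ⟪η, leftReg (g k) ξ⟫_ℂ‖ := e ▸ norm_sum_le _ _
      _ ≤ ∑ k ∈ F, (‖η‖ * ‖restrict (A k) ξ‖ + ‖restrict (A k) η‖ * ‖ξ‖) := by
        refine Finset.sum_le_sum fun k _ => ?_
        rw [norm_mul]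
        exact (mul_le_of_le_one_left (norm_nonneg _) (hc k)).trans
          (norm_inner_leftReg_le (hA k) ξ η)
      _ = ‖η‖ * ∑ k ∈ F, ‖restrict (A k) ξ‖ + (∑ k ∈ F, ‖restrict (A k) η‖) * ‖ξ‖ := by
        rw [Finset.sum_add_distrib, Finset.mul_sum, Finset.sum_mul]
      _ ≤ ‖η‖ * (√(F.card * M) * ‖ξ‖) + √(F.card * M) * ‖η‖ * ‖ξ‖ := by
        gcongr
        · exact sum_norm_restrict_le F A M hM ξ
        · exact sum_norm_restrict_le F A M hM η
      _ = _ := by ring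
  -- Testing against `η = T ξ` gives a bound on `‖T ξ‖ ^ 2` with one factor `‖T ξ‖` to cancel.
  have h := key (T ξ)
  rw [inner_self_eq_norm_sq_to_K, norm_pow] at h
  simp only [Complex.coe_algebraMap, Complex.norm_real, norm_norm] at h
  by_contra! hlt
  have hpos : 0 < ‖T ξ‖ := lt_of_le_of_lt (by positivity) hlt
  nlinarith

end Translations

/-! ### Induction on the reduced `C*`-algebra and the canonical trace -/

section ReducedLemmas

variable {G : Type*} [Group G]

theorem leftReg_one : leftReg (1 : G) = 1 :=
  ContinuousLinearMap.ext fun ξ => lp.ext (funext fun h => by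
    rw [leftReg_apply, inv_one, one_mul]; rfl)

theorem leftReg_mul (g h : G) : leftReg (g * h) = leftReg g * leftReg h :=
  ContinuousLinearMap.ext fun ξ => lp.ext (funext fun x => by
    rw [leftReg_apply, mul_apply_eq_comp, leftReg_apply, leftReg_apply, mul_inv_rev,
      mul_assoc])

theorem star_leftReg (g : G) : star (leftReg g) = leftReg g⁻¹ := by
  rw [ContinuousLinearMap.star_eq_adjoint, eq_comm, ContinuousLinearMap.eq_adjoint_iff]
  intro ξ η
  rw [← (permute (Equiv.mulLeft g)).inner_map_map]
  change ⟪leftReg g (leftReg g⁻¹ ξ), leftReg g η⟫_ℂ = _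
  rw [← mul_apply_eq_comp, ← leftReg_mul, mul_inv_cancel, leftReg_one,
    one_apply_eq_self]

variable (G) in
-- The translations form a group closed under adjoints, so their span is already a `*`-algebra.
theorem adjoin_leftReg_eq_span :
    Subalgebra.toSubmodule (StarAlgebra.adjoin ℂ (Set.range (leftReg (G := G)))).toSubalgebra =
      Submodule.span ℂ (Set.range (leftReg (G := G))) := by
  rw [StarAlgebra.adjoin_eq_span]
  let ρ : G →* (L2 G →L[ℂ] L2 G) := ⟨⟨leftReg, leftReg_one⟩, leftReg_mul⟩
  refine le_antisymm (Submodule.span_mono ?_)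
    (Submodule.span_mono (Set.subset_union_left.trans Submonoid.subset_closure))
  refine (Submonoid.closure_le (S := MonoidHom.mrange ρ)).mpr (Set.union_subset ?_ ?_)
  · rintro _ ⟨g, rfl⟩
    exact ⟨g, rfl⟩
  · rintro a ⟨g, hg⟩
    exact ⟨g⁻¹, by rw [← star_star a, ← hg, star_leftReg]; rfl⟩

/-- No closure under products or adjoints is required of `p`, because the linear span of the
translations is dense. -/
theorem reducedCStar_induction {p : reducedCStar G → Prop} (hcl : IsClosed {x | p x})
    (hadd : ∀ x y, p x → p y → p (x + y)) (hsmul : ∀ (c : ℂ) x, p x → p (c • x))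
    (hreg : ∀ g : G, p ⟨leftReg g, leftReg_mem G g⟩) (x : reducedCStar G) : p x := by
  have hspan : ∀ a ∈ Submodule.span ℂ (Set.range (leftReg (G := G))),
      ∃ h : a ∈ reducedCStar G, p ⟨a, h⟩ := by
    intro a ha
    induction ha using Submodule.span_induction with
    | mem a ha =>
      obtain ⟨g, rfl⟩ := ha
      exact ⟨leftReg_mem G g, hreg g⟩
    | zero =>
      refine ⟨zero_mem _, ?_⟩
      have := hsmul 0 _ (hreg 1)
      rwa [zero_smul] at this
    | add a b _ _ ha hb =>
      obtain ⟨ha, ha'⟩ := ha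
      obtain ⟨hb, hb'⟩ := hb
      exact ⟨add_mem ha hb, hadd _ _ ha' hb'⟩
    | smul c a _ ha =>
      obtain ⟨ha, ha'⟩ := ha
      exact ⟨(reducedCStar G).smul_mem ha c, hsmul c _ ha'⟩
  have hx : x ∈ closure {y | p y} := by
    rw [closure_subtype]
    refine closure_mono (fun a ha => ?_) x.2
    obtain ⟨h, hp⟩ := hspan a (adjoin_leftReg_eq_span G ▸ ha)
    exact ⟨⟨a, h⟩, hp, rfl⟩
  rwa [hcl.closure_eq] at hx

theorem canonicalTrace_leftReg [DecidableEq G] (g : G) :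
    canonicalTrace G ⟨leftReg g, leftReg_mem G g⟩ = if g = 1 then 1 else 0 := by
  rw [canonicalTrace_apply, lp.inner_single_left, leftReg_apply, mul_one]
  split_ifs with h
  · simp [h]
  · simp [lp.single_apply, h]

theorem canonicalTrace_one : canonicalTrace G 1 = 1 := by
  classical
  have h := canonicalTrace_leftReg (1 : G)
  rw [if_pos rfl] at h
  rw [← h]
  exact congrArg _ (Subtype.ext leftReg_one.symm)

theorem norm_canonicalTrace_apply_le (a : reducedCStar G) : ‖canonicalTrace G a‖ ≤ ‖a‖ := by
  classical
  have hδ : ‖(lp.single 2 (1 : G) (1 : ℂ) : L2 G)‖ = 1 := by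
    rw [lp.norm_single (by norm_num), norm_one]
  rw [canonicalTrace_apply]
  refine (norm_inner_le_norm _ _).trans ?_
  have := (a : L2 G →L[ℂ] L2 G).le_opNorm (lp.single 2 (1 : G) (1 : ℂ))
  rw [hδ] at this ⊢
  simpa using this

theorem isState_canonicalTrace : IsState (canonicalTrace G) := by
  classical
  refine ⟨fun a ha => ?_, le_antisymm ?_ ?_⟩
  · rw [canonicalTrace_apply]
    have ha' : (0 : L2 G →L[ℂ] L2 G) ≤ a := ha
    exact (ContinuousLinearMap.nonneg_iff_isPositive _ |>.mp ha').inner_nonneg_right _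
  · refine ContinuousLinearMap.opNorm_le_bound _ zero_le_one fun a => ?_
    exact (norm_canonicalTrace_apply_le a).trans_eq (one_mul _).symm
  · have h := (canonicalTrace G).le_opNorm 1
    have h1 : ‖(1 : reducedCStar G)‖ ≤ 1 := ContinuousLinearMap.norm_id_le
    rw [canonicalTrace_one, norm_one] at h
    nlinarith [norm_nonneg (canonicalTrace G)]

theorem toLin_ofAut_pow_leftReg (β : G ≃* G) (k : ℕ) (g : G) :
    ((MarkovOperator.ofAut (inducedAut β)).toLin ^ k) ⟨leftReg g, leftReg_mem G g⟩ =
      ⟨leftReg (β^[k] g), leftReg_mem G _⟩ := by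
  induction k with
  | zero => rfl
  | succ k ih =>
    rw [pow_succ', Module.End.mul_apply, ih]
    refine (inducedAut_leftReg β _).trans (Subtype.ext ?_)
    rw [Function.iterate_succ_apply']

end ReducedLemmas

theorem norm_toLin_ofAut_pow {A : Type*} [CStarAlgebra A] [PartialOrder A] [StarOrderedRing A]
    (α : A ≃⋆ₐ[ℂ] A) (k : ℕ) (x : A) : ‖((MarkovOperator.ofAut α).toLin ^ k) x‖ = ‖x‖ := by
  induction k with
  | zero => rfl
  | succ k ih =>
    rw [pow_succ', Module.End.mul_apply, ← ih]
    exact StarAlgEquiv.norm_map α _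

/-! ### Vanishing absolute averages -/

section Averages

variable {V : Type*} [SeminormedAddCommGroup V] [NormedSpace ℂ V]

/-- The Cesàro means of `‖D k x‖` tend to zero. -/
def AvgTendstoZero (D : ℕ → V →ₗ[ℂ] ℂ) (x : V) : Prop :=
  Filter.Tendsto (fun n : ℕ => (1 / (n : ℝ)) * ∑ k ∈ Finset.range n, ‖D k x‖) Filter.atTop (𝓝 0)

theorem avg_nonneg (D : ℕ → V →ₗ[ℂ] ℂ) (x : V) (n : ℕ) :
    0 ≤ (1 / (n : ℝ)) * ∑ k ∈ Finset.range n, ‖D k x‖ := by positivity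

theorem AvgTendstoZero.add {D : ℕ → V →ₗ[ℂ] ℂ} {x y : V} (hx : AvgTendstoZero D x)
    (hy : AvgTendstoZero D y) : AvgTendstoZero D (x + y) := by
  refine squeeze_zero (avg_nonneg D _) (fun n => ?_)
    (add_zero (0 : ℝ) ▸ Filter.Tendsto.add hx hy)
  rw [← mul_add, ← Finset.sum_add_distrib]
  gcongr with k
  rw [map_add]
  exact norm_add_le _ _

theorem AvgTendstoZero.smul {D : ℕ → V →ₗ[ℂ] ℂ} {x : V} (c : ℂ) (hx : AvgTendstoZero D x) :
    AvgTendstoZero D (c • x) := by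
  have h := Filter.Tendsto.const_mul ‖c‖ hx
  rw [mul_zero] at h
  refine h.congr fun n => ?_
  rw [mul_left_comm, Finset.mul_sum]
  simp only [map_smul, norm_smul]

theorem isClosed_avgTendstoZero {D : ℕ → V →ₗ[ℂ] ℂ} {C : ℝ} (hD : ∀ k x, ‖D k x‖ ≤ C * ‖x‖) :
    IsClosed {x | AvgTendstoZero D x} := by
  rw [← closure_subset_iff_isClosed]
  intro x hx
  have hC : 0 < |C| + 1 := by positivity
  refine Metric.tendsto_atTop.mpr fun ε hε => ?_
  -- `|C| + 1` replaces `C` to have a positive divisor whatever the sign of `C`.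
  obtain ⟨y, hy, hxy⟩ := Metric.mem_closure_iff.mp hx (ε / 2 / (|C| + 1)) (by positivity)
  obtain ⟨N, hN⟩ := Metric.tendsto_atTop.mp hy (ε / 2) (by positivity)
  refine ⟨N, fun n hn => ?_⟩
  have h1 := hN n hn
  rw [Real.dist_0_eq_abs, abs_of_nonneg (avg_nonneg D _ n)] at h1 ⊢
  rw [dist_eq_norm, lt_div_iff₀ hC] at hxy
  have hk : ∀ k, ‖D k x‖ ≤ ‖x - y‖ * (|C| + 1) + ‖D k y‖ := by
    intro k
    have e : D k x = D k (x - y) + D k y := by rw [← map_add, sub_add_cancel]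
    rw [e]
    refine (norm_add_le _ _).trans (add_le_add_left ((hD k _).trans ?_) _)
    nlinarith [norm_nonneg (x - y), le_abs_self C]
  calc (1 / (n : ℝ)) * ∑ k ∈ Finset.range n, ‖D k x‖
      ≤ (1 / (n : ℝ)) * ∑ k ∈ Finset.range n, (‖x - y‖ * (|C| + 1) + ‖D k y‖) := by
        gcongr with k
        exact hk k
    _ = (n : ℝ) / n * (‖x - y‖ * (|C| + 1)) +
        (1 / (n : ℝ)) * ∑ k ∈ Finset.range n, ‖D k y‖ := by
        rw [Finset.sum_add_distrib, Finset.sum_const, Finset.card_range, nsmul_eq_mul]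
        ring
    _ ≤ ‖x - y‖ * (|C| + 1) + (1 / (n : ℝ)) * ∑ k ∈ Finset.range n, ‖D k y‖ := by
        refine add_le_add ?_ le_rfl
        -- Only `n / n ≤ 1` is used, which also covers `n = 0`, where the quotient is `0`.
        exact mul_le_of_le_one_left (by positivity) (div_self_le_one (n : ℝ))
    _ < ε := by linarith

theorem tendsto_inv_mul_sqrt (C M : ℝ) :
    Filter.Tendsto (fun n : ℕ => (1 / (n : ℝ)) * (C * √(n * M))) Filter.atTop (𝓝 0) := by
  have h : Filter.Tendsto (fun n : ℕ => C * √(M / n)) Filter.atTop (𝓝 0) := by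
    simpa using ((tendsto_const_div_atTop_nhds_zero_nat M).sqrt).const_mul C
  refine h.congr fun n => ?_
  rcases Nat.eq_zero_or_pos n with rfl | hn
  · simp
  have hn' : (0 : ℝ) < n := by exact_mod_cast hn
  have e : M / n = n * M / (n : ℝ) ^ 2 := by field_simp
  rw [e, Real.sqrt_div' _ (by positivity), Real.sqrt_sq hn'.le]
  ring

end Averages

/-! ### Reduction to translations -/

section InducedAut

theorem tendsto_avg_of_leftReg {G : Type*} [Group G] (β : G ≃* G) (φ : reducedCStar G →L[ℂ] ℂ)
    (H : ∀ g ≠ 1, Filter.Tendsto (fun n : ℕ => (1 / (n : ℝ)) * ∑ k ∈ Finset.range n,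
      ‖φ ⟨leftReg (β^[k] g), leftReg_mem G _⟩‖) Filter.atTop (𝓝 0)) (x : reducedCStar G) :
    Filter.Tendsto (fun n : ℕ => (1 / (n : ℝ)) * ∑ k ∈ Finset.range n,
      ‖φ (((MarkovOperator.ofAut (inducedAut β)).toLin ^ k) x) -
        φ (traceExpectation G x)‖) Filter.atTop (𝓝 0) := by
  classical
  let D : ℕ → reducedCStar G →ₗ[ℂ] ℂ := fun k =>
    φ.toLinearMap ∘ₗ ((MarkovOperator.ofAut (inducedAut β)).toLin ^ k) -
      φ.toLinearMap ∘ₗ traceExpectation G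
  have hE : ∀ y, φ (traceExpectation G y) = canonicalTrace G y * φ 1 := fun y =>
    map_smul φ (canonicalTrace G y) 1
  have hD : ∀ k y, D k y = φ (((MarkovOperator.ofAut (inducedAut β)).toLin ^ k) y) -
    canonicalTrace G y * φ 1 := fun k y => congrArg (φ _ - ·) (hE y)
  change AvgTendstoZero D x
  have hbound : ∀ k y, ‖D k y‖ ≤ (‖φ‖ + ‖φ 1‖) * ‖y‖ := by
    intro k y
    have h1 : ‖φ (((MarkovOperator.ofAut (inducedAut β)).toLin ^ k) y)‖ ≤ ‖φ‖ * ‖y‖ :=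
      (φ.le_opNorm _).trans_eq (congrArg (‖φ‖ * ·) (norm_toLin_ofAut_pow _ k y))
    have h2 : ‖φ (traceExpectation G y)‖ ≤ ‖y‖ * ‖φ 1‖ := by
      rw [hE, norm_mul]
      exact mul_le_mul_of_nonneg_right (norm_canonicalTrace_apply_le y) (norm_nonneg _)
    rw [add_mul, mul_comm ‖φ 1‖]
    exact (norm_sub_le _ _).trans (add_le_add h1 h2)
  have hcl : IsClosed {y | AvgTendstoZero D y} := isClosed_avgTendstoZero hbound
  have hadd : ∀ y z, AvgTendstoZero D y → AvgTendstoZero D z → AvgTendstoZero D (y + z) :=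
    fun _ _ => AvgTendstoZero.add
  have hsmul : ∀ (c : ℂ) y, AvgTendstoZero D y → AvgTendstoZero D (c • y) :=
    fun c _ => AvgTendstoZero.smul c
  refine reducedCStar_induction (p := fun y => AvgTendstoZero D y) hcl hadd hsmul (fun g => ?_) x
  have hreg : ∀ k, D k ⟨leftReg g, leftReg_mem G g⟩ =
      φ ⟨leftReg (β^[k] g), leftReg_mem G _⟩ - (if g = 1 then 1 else 0) * φ 1 := fun k =>
    (hD k _).trans (congrArg₂ (· - ·) (congrArg φ (toLin_ofAut_pow_leftReg β k g))
      (congrArg (· * φ 1) (canonicalTrace_leftReg g)))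
  by_cases hg : g = 1
  · have h1 : ∀ k, (⟨leftReg (β^[k] g), leftReg_mem G _⟩ : reducedCStar G) = 1 := fun k =>
      Subtype.ext ((congrArg leftReg (by rw [hg, iterate_map_one])).trans leftReg_one)
    have h0 : ∀ k, D k ⟨leftReg g, leftReg_mem G g⟩ = 0 := by
      intro k
      rw [hreg, if_pos hg, h1, one_mul, sub_self]
    simp [AvgTendstoZero, h0]
  · refine (H g hg).congr fun n => ?_
    simp only [hreg, if_neg hg, zero_mul, sub_zero]

theorem canonicalTrace_inducedAut {G : Type*} [Group G] (β : G ≃* G) (x : reducedCStar G) :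
    canonicalTrace G (inducedAut β x) = canonicalTrace G x := by
  classical
  refine reducedCStar_induction (p := fun x => canonicalTrace G (inducedAut β x) = _)
    (isClosed_eq ?_ (canonicalTrace G).continuous) (fun y z hy hz => ?_) (fun c y hy => ?_)
    (fun g => ?_) x
  · exact (canonicalTrace G).continuous.comp (map_continuous (inducedAut β))
  · rw [map_add, map_add, map_add, hy, hz]
  · rw [map_smul, map_smul, map_smul, hy]
  · rw [inducedAut_leftReg, canonicalTrace_leftReg, canonicalTrace_leftReg]
    simp

end InducedAut

/-! ### The free shift -/

section FreeShift

theorem freeShift_iterate (k : ℕ) (g : FreeGroup ℤ) :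
    freeShift^[k] g = FreeGroup.map (fun i : ℤ => i + k) g := by
  induction k with
  | zero => simp
  | succ k ih =>
    rw [Function.iterate_succ_apply', ih]
    refine (FreeGroup.map.comp _ _ g).trans (congrArg (fun f => FreeGroup.map f g) ?_)
    funext i
    simp [add_assoc]

/-- Injective relabelling creates no new cancelling neighbours, so the image word is still reduced.
-/
theorem _root_.FreeGroup.toWord_map_of_injective {α β : Type*} [DecidableEq α] [DecidableEq β]
    {f : α → β} (hf : Function.Injective f) (g : FreeGroup α) :
    (FreeGroup.map f g).toWord = g.toWord.map fun x => (f x.1, x.2) := by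
  conv_lhs => rw [← FreeGroup.mk_toWord (x := g), FreeGroup.map.mk, FreeGroup.toWord_mk]
  refine FreeGroup.IsReduced.reduce_eq (List.isChain_map_of_isChain _ (fun a b h => ?_)
    FreeGroup.isReduced_toWord)
  exact fun e => h (hf e)

theorem _root_.FreeGroup.toWord_mul_of_disjoint {α : Type*} [DecidableEq α] {g h : FreeGroup α}
    (H : ∀ x ∈ g.toWord, ∀ y ∈ h.toWord.head?, x.1 ≠ y.1) :
    (g * h).toWord = g.toWord ++ h.toWord := by
  rw [FreeGroup.toWord_mul]
  refine FreeGroup.IsReduced.reduce_eq (List.isChain_append.mpr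
    ⟨FreeGroup.isReduced_toWord, FreeGroup.isReduced_toWord, fun x hx y hy e => ?_⟩)
  exact absurd e (H x (List.mem_of_mem_getLast? hx) y hy)

/-- The words whose first letter has its index among those of the letters of `g` shifted by `k`. -/
def startSet (g : FreeGroup ℤ) (k : ℕ) : Set (FreeGroup ℤ) :=
  {h | ∃ y ∈ h.toWord.head?, ∃ x ∈ g.toWord, y.1 = x.1 + k}

/-- Nothing cancels, so the product begins with the first letter of the shifted `g`; this letter
exists because `g ≠ 1`. -/
theorem mul_mem_startSet {g : FreeGroup ℤ} (hg : g ≠ 1) (k : ℕ) {h : FreeGroup ℤ}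
    (hh : h ∉ startSet g k) : freeShift^[k] g * h ∈ startSet g k := by
  have hw : (freeShift^[k] g).toWord = g.toWord.map fun x => (x.1 + (k : ℤ), x.2) := by
    rw [freeShift_iterate]
    exact FreeGroup.toWord_map_of_injective (add_left_injective _) g
  have hmul : (freeShift^[k] g * h).toWord = (freeShift^[k] g).toWord ++ h.toWord := by
    refine FreeGroup.toWord_mul_of_disjoint fun x hx y hy e => hh ?_
    rw [hw] at hx
    obtain ⟨z, hz, rfl⟩ := List.mem_map.mp hx
    exact ⟨y, hy, z, hz, e.symm⟩
  have hne : g.toWord ≠ [] := fun h0 => hg (FreeGroup.toWord_eq_nil_iff.mp h0)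
  obtain ⟨x, l, hl⟩ := List.exists_cons_of_ne_nil hne
  refine ⟨(x.1 + k, x.2), ?_, x, by simp [hl], rfl⟩
  rw [hmul, hw, hl]
  simp

theorem card_le_of_forall_mem_startSet (g h : FreeGroup ℤ) (F : Finset ℕ)
    (hF : ∀ k ∈ F, h ∈ startSet g k) : F.card ≤ g.toWord.length := by
  rcases hh : h.toWord.head? with _ | y
  · have : F = ∅ := Finset.eq_empty_of_forall_notMem fun k hk => by
      obtain ⟨y, hy, -⟩ := hF k hk
      simp [hh] at hy
    simp [this]
  -- With the first letter `y` of `h` fixed, `k ↦ y.1 - k` injects `F` into the indices occurring in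
  -- `g`.
  · refine le_trans (Finset.card_le_card_of_injOn (t := (g.toWord.map Prod.fst).toFinset)
      (fun k : ℕ => y.1 - (k : ℤ)) ?_ ?_) ((List.toFinset_card_le _).trans_eq (by simp))
    · intro k hk
      obtain ⟨y', hy', x, hx, e⟩ := hF k hk
      obtain rfl : y = y' := by simpa [hh] using hy'
      have e' : y.1 - (k : ℤ) = x.1 := by omega
      simp only [e', List.coe_toFinset, Set.mem_ofPred_eq]
      exact List.mem_map_of_mem hx
    · intro k _ l _ e
      simpa using e

/-- The phases `c k` turn the sum of absolute values into `φ` of a single operator, whose norm the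
ping-pong bound controls. -/
theorem sum_norm_apply_leftReg_le {g : FreeGroup ℤ} (hg : g ≠ 1)
    (φ : reducedCStar (FreeGroup ℤ) →L[ℂ] ℂ) (n : ℕ) :
    ∑ k ∈ Finset.range n, ‖φ ⟨leftReg (freeShift^[k] g), leftReg_mem _ _⟩‖ ≤
      ‖φ‖ * 2 * √(n * g.toWord.length) := by
  choose c hc hφ using fun k : ℕ =>
    Complex.exists_norm_eq_mul_self (φ ⟨leftReg (freeShift^[k] g), leftReg_mem _ _⟩)
  set x : reducedCStar (FreeGroup ℤ) := ∑ k ∈ Finset.range n,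
    c k • ⟨leftReg (freeShift^[k] g), leftReg_mem _ _⟩ with hx
  have hxn : ‖x‖ ≤ 2 * √(n * g.toWord.length) := by
    have h := norm_sum_smul_leftReg_le (Finset.range n) (fun k => freeShift^[k] g) (startSet g)
      g.toWord.length (fun k h hh => mul_mem_startSet hg k hh)
      (card_le_of_forall_mem_startSet g) c (fun k => (hc k).le)
    rw [Finset.card_range] at h
    refine le_trans (le_of_eq ?_) h
    change ‖(x : L2 (FreeGroup ℤ) →L[ℂ] L2 (FreeGroup ℤ))‖ = _
    rw [hx]
    simp
  have hφx : ((∑ k ∈ Finset.range n,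
      ‖φ ⟨leftReg (freeShift^[k] g), leftReg_mem _ _⟩‖ : ℝ) : ℂ) = φ x := by
    rw [hx, map_sum, Complex.ofReal_sum]
    refine Finset.sum_congr rfl fun k _ => ?_
    rw [map_smul, smul_eq_mul, hφ]
  calc _ = ‖φ x‖ := by
        rw [← hφx, Complex.norm_real, Real.norm_of_nonneg (by positivity)]
    _ ≤ ‖φ‖ * ‖x‖ := φ.le_opNorm x
    _ ≤ ‖φ‖ * (2 * √(n * g.toWord.length)) := by gcongr
    _ = _ := by ring

theorem tendsto_avg_freeShift (φ : reducedCStar (FreeGroup ℤ) →L[ℂ] ℂ)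
    (x : reducedCStar (FreeGroup ℤ)) :
    Filter.Tendsto (fun n : ℕ => (1 / (n : ℝ)) * ∑ k ∈ Finset.range n,
      ‖φ (((MarkovOperator.ofAut (inducedAut freeShift)).toLin ^ k) x) -
        φ (traceExpectation (FreeGroup ℤ) x)‖) Filter.atTop (𝓝 0) := by
  refine tendsto_avg_of_leftReg freeShift φ (fun g hg => ?_) x
  refine squeeze_zero (fun n => by positivity) (fun n => ?_)
    (tendsto_inv_mul_sqrt (‖φ‖ * 2) g.toWord.length)
  exact mul_le_mul_of_nonneg_left (sum_norm_apply_leftReg_le hg φ n) (by positivity)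

end FreeShift

end CStarDyn

end

theorem mainTheorem3 :
    CStarDyn.IsStrictlyWeakMixingWrt
      (CStarDyn.MarkovOperator.ofAut (CStarDyn.inducedAut CStarDyn.freeShift))
      (CStarDyn.traceExpectation (FreeGroup ℤ)) ∧
    CStarDyn.IsStrictlyWeakMixingState
      (CStarDyn.MarkovOperator.ofAut (CStarDyn.inducedAut CStarDyn.freeShift))
      (CStarDyn.canonicalTrace (FreeGroup ℤ)) := by
  have hE : ∀ ψ : CStarDyn.reducedCStar (FreeGroup ℤ) →L[ℂ] ℂ, CStarDyn.IsState ψ → ∀ x,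
      ψ (CStarDyn.traceExpectation (FreeGroup ℤ) x) =
        CStarDyn.canonicalTrace (FreeGroup ℤ) x := by
    intro ψ hψ x
    change ψ (CStarDyn.canonicalTrace (FreeGroup ℤ) x • 1) = _
    rw [map_smul, hψ.map_one, smul_eq_mul, mul_one]
  refine ⟨fun φ _ => CStarDyn.tendsto_avg_freeShift φ,
    ⟨CStarDyn.isState_canonicalTrace, CStarDyn.canonicalTrace_inducedAut _⟩,
    fun ψ hψ hinv => ?_, fun ψ hψ x => ?_⟩
  · ext x
    have hpow : ∀ k, ψ (((CStarDyn.MarkovOperator.ofAut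
        (CStarDyn.inducedAut CStarDyn.freeShift)).toLin ^ k) x) = ψ x := by
      intro k
      induction k with
      | zero => rfl
      | succ k ih => rw [pow_succ', Module.End.mul_apply, hinv, ih]
    -- By invariance every term of this average is `‖ψ x - τ x‖`, so for `n > 0` the average is that
    -- constant, and its limit is zero.
    have h := CStarDyn.tendsto_avg_freeShift ψ x
    simp only [hpow, hE ψ hψ, Finset.sum_const, Finset.card_range, nsmul_eq_mul] at h
    have h' : ‖ψ x - CStarDyn.canonicalTrace (FreeGroup ℤ) x‖ = 0 := by
      refine tendsto_nhds_unique (tendsto_const_nhds.congr' ?_) h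
      filter_upwards [Filter.eventually_gt_atTop 0] with n hn
      have : (n : ℝ) ≠ 0 := by exact_mod_cast hn.ne'
      field_simp
    exact sub_eq_zero.mp (norm_eq_zero.mp h')
  · simpa only [hE ψ hψ] using CStarDyn.tendsto_avg_freeShift ψ x
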